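/- Let $K$ be an algebraically closed field of characteristic zero and let $X=V(f)\subset\mathbb P^4$ be an irreducible cubic hypersurface, where $f\in K[x_0,\dots,x_4]$ is an irreducible homogeneous polynomial of degree $3$. Assume that $X$ has vanishing hessian, i.e. $\det\left(\frac{\partial^2 f}{\partial x_i\partial x_j}\right)_{0\le i,j\le 4}=0$ as a polynomial, and that $X$ is not a cone, i.e. there is no point $p\in X$ such that for every $q\in X$ the line joining $p$ and $q$ is contained in $X$. Then: i) the set-theoretic singular locus $(\operatorname{Sing}X)_{\mathrm{red}}=\{p\in\mathbb P^4 : \frac{\partial f}{\partial x_i}(p)=0 \text{ for } i=0,\dots,4\}$ is a plane, i.e. a linear subspace $\mathbb P^2\subset\mathbb P^4$; ii) the dual variety $X^*\subset(\mathbb P^4)^*$, i.e. the Zariski closure of the set of tangent hyperplanes to $X$ at its smooth points, is, in dual coordinates, projectively equivalent to the rational normal scroll $S(1,2)=\{(as:at:bs^2:bst:bt^2) : (s:t),(a:b)\in\mathbb P^1\}\subset\mathbb P^4$; iii) $X$ is projectively equivalent to a linear external projection of the Segre variety $\operatorname{Seg}(1,2)=\mathbb P^1\times\mathbb P^2\subset\mathbb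 P^5$, i.e. to the image of $\operatorname{Seg}(1,2)$ under the linear projection $\mathbb P^5\dashrightarrow\mathbb P^4$ from some point of $\mathbb P^5\setminus\operatorname{Seg}(1,2)$; iv) $X$ is projectively equivalent to $V(x_0x_3^2+2x_1x_3x_4+x_2x_4^2)\subset\mathbb P^4$; that is, some invertible linear change of coordinates transforms $f$ into a non-zero scalar multiple of $x_0x_3^2+2x_1x_3x_4+x_2x_4^2$. -/

import Mathlib

open scoped LinearAlgebra.Projectivization

namespace CubicP4

section General

variable {K : Type*} [Field K] {V W : Type*} [AddCommGroup V] [Module K V]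
  [AddCommGroup W] [Module K W] {n : ℕ}

/-- The points of the linear subspace of `ℙ(V)` attached to a vector subspace `U` of `V`. -/
def linearSubspace (U : Submodule K V) : Set (ℙ K V) := {p | p.submodule ≤ U}

/-- A plane (a linear subspace of projective dimension two). -/
def IsPlane (S : Set (ℙ K V)) : Prop :=
  ∃ U : Submodule K V, Module.finrank K U = 3 ∧ S = linearSubspace U

/-- The line joining `p` and `q` (it is just the point `p` if `p = q`). -/
def joinLine (p q : ℙ K V) : Set (ℙ K V) := linearSubspace (p.submodule ⊔ q.submodule)

/-- The vertex of `X`: the points `p` of `X` such that the line joining `p` to any point of `X`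
lies in `X`. -/
def vertex (X : Set (ℙ K V)) : Set (ℙ K V) := {p | p ∈ X ∧ ∀ q ∈ X, joinLine p q ⊆ X}

/-- A cone is a set with non-empty vertex. -/
def IsCone (X : Set (ℙ K V)) : Prop := (vertex X).Nonempty

/-- `X` and `Y` are exchanged by a projective transformation of the ambient space. -/
def ProjectivelyEquivalent (X Y : Set (ℙ K V)) : Prop :=
  ∃ g : V ≃ₗ[K] V, Projectivization.map g.toLinearMap g.injective '' X = Y

/-- `X` is the image of `Y ⊆ ℙ(V)` under the linear projection from a point `p` outside `Y`.
The projection is induced by a surjective linear map `L : V → W` whose kernel is the line `p`;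
as `p` is not in `Y`, it is defined at all points of `Y`. -/
def IsExternalProjection (Y : Set (ℙ K V)) (X : Set (ℙ K W)) : Prop :=
  ∃ p : ℙ K V, p ∉ Y ∧ ∃ L : V →ₗ[K] W, Function.Surjective L ∧
    LinearMap.ker L = p.submodule ∧
    X = {x | ∃ y ∈ Y, x.submodule = y.submodule.map L}

/-- The zero locus in projective space of a homogeneous polynomial. -/
def zeroLocus (f : MvPolynomial (Fin n) K) : Set (ℙ K (Fin n → K)) :=
  {p | ∀ v ∈ p.submodule, MvPolynomial.eval v f = 0}

/-- The Zariski closure of a subset of projective space. -/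
def zariskiClosure (S : Set (ℙ K (Fin n → K))) : Set (ℙ K (Fin n → K)) :=
  {p | ∀ (d : ℕ) (F : MvPolynomial (Fin n) K), F.IsHomogeneous d →
    S ⊆ zeroLocus F → p ∈ zeroLocus F}

/-- The Hessian matrix of `f`. -/
noncomputable def hessianMatrix (f : MvPolynomial (Fin n) K) :
    Matrix (Fin n) (Fin n) (MvPolynomial (Fin n) K) :=
  Matrix.of fun i j => MvPolynomial.pderiv i (MvPolynomial.pderiv j f)

/-- The hessian of `f`, the determinant of its Hessian matrix. -/
noncomputable def hessian (f : MvPolynomial (Fin n) K) : MvPolynomial (Fin n) K :=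
  (hessianMatrix f).det

/-- The gradient of `f` at the vector `v`. -/
noncomputable def gradient (f : MvPolynomial (Fin n) K) (v : Fin n → K) : Fin n → K :=
  fun i => MvPolynomial.eval v (MvPolynomial.pderiv i f)

/-- The set of points underlying the singular scheme `V(∂f/∂x_0, …, ∂f/∂x_N)` of `V(f)`. -/
def singularLocus (f : MvPolynomial (Fin n) K) : Set (ℙ K (Fin n → K)) :=
  {p | ∀ i, p ∈ zeroLocus (MvPolynomial.pderiv i f)}

/-- The image of the Gauss map of the reduced hypersurface `V(f)`: the tangent hyperplanes at its
smooth points, as points of the dual projective space in dual homogeneous coordinates. -/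
def gaussImage (f : MvPolynomial (Fin n) K) : Set (ℙ K (Fin n → K)) :=
  {h | ∃ p ∈ zeroLocus f, ∃ v ∈ p.submodule, gradient f v ≠ 0 ∧
    h.submodule = Submodule.span K {gradient f v}}

/-- The dual variety of the reduced hypersurface `V(f)`. -/
def dualVariety (f : MvPolynomial (Fin n) K) : Set (ℙ K (Fin n → K)) :=
  zariskiClosure (gaussImage f)

/-- A projective transformation carries the hypersurface `V(f)` onto the hypersurface `V(h)`, and
pulls the equation `h` back to a non-zero multiple of `f`. Over an infinite field the last
condition, stated on values, is the identity of polynomials. -/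
def ProjectivelyEquivalentHypersurfaces (f h : MvPolynomial (Fin n) K) : Prop :=
  ∃ g : (Fin n → K) ≃ₗ[K] (Fin n → K),
    Projectivization.map g.toLinearMap g.injective '' zeroLocus f = zeroLocus h ∧
    ∃ c : K, c ≠ 0 ∧ ∀ v, MvPolynomial.eval (g v) h = c * MvPolynomial.eval v f

end General

section Varieties

variable (K : Type*) [Field K]

/-- The Segre variety `Seg(1,2) ⊂ ℙ⁵ = ℙ(M_{2×3}(K))`, the image of
`ℙ¹ × ℙ² → ℙ⁵, ([a], [b]) ↦ [a_i b_j]`. -/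
def segreVariety : Set (ℙ K (Matrix (Fin 2) (Fin 3) K)) :=
  {p | ∃ (a : Fin 2 → K) (b : Fin 3 → K), a ≠ 0 ∧ b ≠ 0 ∧
    p.submodule = Submodule.span K {Matrix.vecMulVec a b}}

/-- The cubic rational normal scroll `S(1,2) ⊂ ℙ⁴`: the union of the lines joining the points
`(s : t : 0 : 0 : 0)` of a line and `(0 : 0 : s² : st : t²)` of a conic in a complementary plane,
for `(s : t)` in `ℙ¹`. -/
def cubicScroll : Set (ℙ K (Fin 5 → K)) :=
  {p | ∃ s t a b : K, (s ≠ 0 ∨ t ≠ 0) ∧ (a ≠ 0 ∨ b ≠ 0) ∧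
    p.submodule = Submodule.span K {![a * s, a * t, b * s ^ 2, b * (s * t), b * t ^ 2]}}

open MvPolynomial in
/-- The form `x₀x₃² + 2x₁x₃x₄ + x₂x₄²`. -/
noncomputable def canonicalCubic : MvPolynomial (Fin 5) K :=
  X 0 * X 3 ^ 2 + 2 * X 1 * X 3 * X 4 + X 2 * X 4 ^ 2

end Varieties

end CubicP4

namespace CubicP4

/-! ### The symmetric trilinear form of a cubic, cones and translations -/

section Cubic

variable {K : Type*} [Field K] {n : ℕ} {f : MvPolynomial (Fin n) K}

/-! Let `T` be the symmetric trilinear form with `T(x,x,x) = 6f`; `polar` is `(u,v) ↦ T(u,v,·)` and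
the Hessian matrix at `x` is `T(x,·,·)`. If its determinant vanishes, there is a polynomial vector
field `n ≠ 0` with `T(x,n,·) = 0`. Differentiating this relation gives `T(n,n,·) = 0`, then
`T(n,∂ᵢn,·) = 0`, then a formula for `T(∂ⱼn,∂ᵢn,·)`. In five variables a dimension count
(`finrank_range_le_one`) turns these relations into the key fact: the quadric `T(n,·,·)` has rank at
most one.

So each value `w` of `n` satisfies `T(w,·,·) = ℓ²` for a linear form `ℓ`. Since `X` is not a cone,
`w ↦ T(w,·,·)` is injective, so proportional `ℓ` come from proportional `w`. Hence `T(w,w',·) = 0`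
for any two values, and `T` kills pairs of vectors of their span. This span has dimension at least 3
(`exists_plane`): if all values lay on one line, its direction would be killed by `T`. If they
spanned a plane of vectors, a sum of two independent squares would have to be a square, so the
values would lie on two lines, impossible for a polynomial map unless one line suffices.

A three-dimensional `W` with `T(W,W,·) = 0` makes `f` linear along `W`. With `y₀, y₁` coordinates on
a complement, `f` is `y₀²`, `2y₀y₁`, `y₁²` with linear coefficients, and these five linear forms are
independent because `X` is not a cone (`exists_linearEquiv`). The remaining assertions are invariant
under linear changes of coordinates and are checked on the canonical cubic. -/

theorem pderiv_pderiv_comm (i j : Fin n) (f : MvPolynomial (Fin n) K) :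
    MvPolynomial.pderiv i (MvPolynomial.pderiv j f) =
      MvPolynomial.pderiv j (MvPolynomial.pderiv i f) := by
  have h : ⁅MvPolynomial.pderiv (R := K) i, MvPolynomial.pderiv (R := K) j⁆ = 0 := by
    apply MvPolynomial.derivation_ext
    intro k
    classical
    simp [Derivation.commutator_apply, MvPolynomial.pderiv_X, Pi.single_apply, apply_ite]
  have := congrArg (fun D => D f) h
  simpa [Derivation.commutator_apply, sub_eq_zero] using this

/-- The third partial derivatives of a cubic form. -/
noncomputable def thirdPartials (f : MvPolynomial (Fin n) K) (i j k : Fin n) : K :=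
  MvPolynomial.constantCoeff
    (MvPolynomial.pderiv i (MvPolynomial.pderiv j (MvPolynomial.pderiv k f)))

theorem thirdPartials_swap₁₂ (i j k : Fin n) :
    thirdPartials f i j k = thirdPartials f j i k := by
  rw [thirdPartials, pderiv_pderiv_comm, thirdPartials]

theorem thirdPartials_swap₂₃ (i j k : Fin n) :
    thirdPartials f i j k = thirdPartials f i k j := by
  rw [thirdPartials, pderiv_pderiv_comm j k, thirdPartials]

/-- The bilinear map `(u, v) ↦ T(u, v, ·)` given by the symmetric trilinear form `T` of third
partial derivatives of `f`, over a `K`-algebra `A`. -/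
noncomputable def polar (f : MvPolynomial (Fin n) K) (A : Type*) [CommRing A] [Algebra K A] :
    (Fin n → A) →ₗ[A] (Fin n → A) →ₗ[A] (Fin n → A) :=
  LinearMap.mk₂ A
    (fun u v k => ∑ i, ∑ j, algebraMap K A (thirdPartials f i j k) * (u i * v j))
    (fun u u' v => by ext k; simp [add_mul, mul_add, Finset.sum_add_distrib])
    (fun c u v => by ext k; simp [Finset.mul_sum, mul_left_comm, mul_assoc])
    (fun u v v' => by ext k; simp [mul_add, Finset.sum_add_distrib])
    (fun c u v => by ext k; simp [Finset.mul_sum, mul_left_comm])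

section Algebra

variable {A A' : Type*} [CommRing A] [Algebra K A] [CommRing A'] [Algebra K A']

theorem polar_apply (u v : Fin n → A) (k : Fin n) :
    polar f A u v k = ∑ i, ∑ j, algebraMap K A (thirdPartials f i j k) * (u i * v j) := rfl

theorem polar_comm (u v : Fin n → A) : polar f A u v = polar f A v u := by
  ext k
  rw [polar_apply, polar_apply, Finset.sum_comm]
  simp_rw [thirdPartials_swap₁₂ (f := f) _ _ k, mul_comm]

theorem polar_dotProduct_comm (u v w : Fin n → A) :
    polar f A u v ⬝ᵥ w = polar f A u w ⬝ᵥ v := by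
  simp only [dotProduct, polar_apply, Finset.sum_mul]
  rw [Finset.sum_comm]
  conv_rhs => rw [Finset.sum_comm]
  refine Finset.sum_congr rfl fun i _ => ?_
  rw [Finset.sum_comm]
  refine Finset.sum_congr rfl fun j _ => Finset.sum_congr rfl fun k _ => ?_
  rw [thirdPartials_swap₂₃]
  ring

theorem map_polar (φ : A →ₐ[K] A') (u v : Fin n → A) :
    (fun k => φ (polar f A u v k)) = polar f A' (fun i => φ (u i)) (fun i => φ (v i)) := by
  ext k
  simp [polar_apply]

theorem pderiv_polar (i : Fin n) (u v : Fin n → MvPolynomial (Fin n) K) :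
    (fun k => MvPolynomial.pderiv i (polar f (MvPolynomial (Fin n) K) u v k)) =
      polar f _ (fun k => MvPolynomial.pderiv i (u k)) v +
        polar f _ u (fun k => MvPolynomial.pderiv i (v k)) := by
  ext1 k
  simp only [polar_apply, Pi.add_apply, map_sum, ← Finset.sum_add_distrib,
    MvPolynomial.algebraMap_eq, MvPolynomial.pderiv_C_mul]
  simp only [MvPolynomial.pderiv_mul, mul_add]

end Algebra

/-- The second partials are linear forms, so Euler's identity recovers them from their constant
derivatives. -/
theorem hessianMatrix_apply_eq (hf : f.IsHomogeneous 3) (j k : Fin n) :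
    hessianMatrix f j k =
      ∑ i, MvPolynomial.C (thirdPartials f i j k) * MvPolynomial.X i := by
  have h1 : (MvPolynomial.pderiv j (MvPolynomial.pderiv k f)).IsHomogeneous 1 := hf.pderiv.pderiv
  have h := h1.sum_X_mul_pderiv
  rw [one_smul] at h
  rw [hessianMatrix, Matrix.of_apply, ← h]
  refine Finset.sum_congr rfl fun i _ => ?_
  have h0 := h1.pderiv (i := i)
  rw [Nat.sub_self, ← MvPolynomial.totalDegree_zero_iff_isHomogeneous,
    MvPolynomial.totalDegree_eq_zero_iff_eq_C] at h0
  rw [h0, thirdPartials, MvPolynomial.constantCoeff_eq, mul_comm]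

theorem polar_X (hf : f.IsHomogeneous 3) (v : Fin n → MvPolynomial (Fin n) K) :
    polar f _ MvPolynomial.X v = (hessianMatrix f).mulVec v := by
  ext1 k
  rw [polar_apply, Matrix.mulVec, dotProduct, Finset.sum_comm]
  refine Finset.sum_congr rfl fun j _ => ?_
  rw [hessianMatrix_apply_eq hf, Finset.sum_mul]
  refine Finset.sum_congr rfl fun i _ => ?_
  rw [thirdPartials_swap₂₃, MvPolynomial.algebraMap_eq]
  ring

theorem polar_X_X (hf : f.IsHomogeneous 3) (k : Fin n) :
    polar f _ MvPolynomial.X MvPolynomial.X k = 2 * MvPolynomial.pderiv k f := by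
  have h := (hf.pderiv (i := k)).sum_X_mul_pderiv
  rw [polar_X hf, Matrix.mulVec, dotProduct]
  simp only [hessianMatrix, Matrix.of_apply]
  simp_rw [pderiv_pderiv_comm k, mul_comm _ (MvPolynomial.X _)]
  rw [h]
  simp

theorem polar_X_X_X (hf : f.IsHomogeneous 3) :
    polar f _ MvPolynomial.X MvPolynomial.X ⬝ᵥ MvPolynomial.X = 6 * f := by
  have h := hf.sum_X_mul_pderiv
  simp_rw [dotProduct, polar_X_X hf, mul_assoc, mul_comm _ (MvPolynomial.X _)]
  rw [← Finset.mul_sum, h]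
  simp
  ring

theorem polar_self (hf : f.IsHomogeneous 3) (v : Fin n → K) :
    polar f K v v = (2 : K) • gradient f v := by
  have h := map_polar (f := f) (MvPolynomial.aeval (R := K) v) MvPolynomial.X MvPolynomial.X
  simp only [polar_X_X hf, MvPolynomial.aeval_X] at h
  rw [← h]
  ext k
  simp [gradient, MvPolynomial.aeval_eq_eval]

theorem polar_self_self (hf : f.IsHomogeneous 3) (v : Fin n → K) :
    polar f K v v ⬝ᵥ v = 6 * MvPolynomial.eval v f := by
  have h := map_polar (f := f) (MvPolynomial.aeval (R := K) v) MvPolynomial.X MvPolynomial.X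
  have h' := congrArg (MvPolynomial.aeval (R := K) v) (polar_X_X_X hf)
  simp only [MvPolynomial.aeval_X] at h
  rw [← h]
  simpa [dotProduct, MvPolynomial.aeval_eq_eval] using h'

/-- Taylor expansion of a cubic: expand `T(v+w,v+w,v+w)` by trilinearity and symmetry. -/
theorem eval_add (hf : f.IsHomogeneous 3) (v w : Fin n → K) :
    6 * MvPolynomial.eval (v + w) f = 6 * MvPolynomial.eval v f + 3 * (polar f K v v ⬝ᵥ w) +
      3 * (polar f K w w ⬝ᵥ v) + 6 * MvPolynomial.eval w f := by
  simp only [← polar_self_self hf, map_add, LinearMap.add_apply, add_dotProduct, dotProduct_add]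
  rw [polar_comm w v, polar_dotProduct_comm v w v, polar_dotProduct_comm v w w,
    polar_comm v w, polar_dotProduct_comm w v w]
  ring

/-- The part of the Taylor expansion odd in `v` isolates the gradient. Expressing it by values alone
lets it be transported along a linear map without a chain rule for polynomials. -/
theorem gradient_dotProduct [CharZero K] (hf : f.IsHomogeneous 3) (v w : Fin n → K) :
    2 * (gradient f v ⬝ᵥ w) =
      MvPolynomial.eval (v + w) f - MvPolynomial.eval (v - w) f - 2 * MvPolynomial.eval w f := by
  have h1 := eval_add hf v w
  have h2 := eval_add hf v (-w)
  have h3 := polar_self_self hf (-w)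
  rw [← sub_eq_add_neg] at h2
  simp only [map_neg, LinearMap.neg_apply, neg_neg, dotProduct_neg, polar_self_self hf w] at h2 h3
  rw [polar_self hf v] at h1 h2
  simp only [smul_dotProduct, smul_eq_mul] at h1 h2
  have h6 : (6 : K) ≠ 0 := by norm_num
  apply mul_left_cancel₀ h6
  linear_combination h2 - h1 - h3

theorem eval_smul_of_isHomogeneous {d : ℕ} {F : MvPolynomial (Fin n) K} (hF : F.IsHomogeneous d)
    (c : K) (v : Fin n → K) : MvPolynomial.eval (c • v) F = c ^ d * MvPolynomial.eval v F := by
  rw [MvPolynomial.eval_eq, MvPolynomial.eval_eq, Finset.mul_sum]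
  refine Finset.sum_congr rfl fun m hm => ?_
  have := hF (MvPolynomial.mem_support_iff.mp hm)
  simp only [Pi.smul_apply, smul_eq_mul, mul_pow, Finset.prod_mul_distrib,
    Finset.prod_pow_eq_pow_sum]
  rw [← this, Finsupp.weight_apply, Finsupp.sum_fintype _ _ (by simp)]
  simp only [Pi.one_apply, smul_eq_mul, mul_one]
  rw [← Finset.sum_subset (Finset.subset_univ m.support) (by simp)]
  ring

theorem mk_mem_zeroLocus {d : ℕ} {F : MvPolynomial (Fin n) K} (hF : F.IsHomogeneous d)
    {v : Fin n → K} (hv : v ≠ 0) :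
    Projectivization.mk K v hv ∈ zeroLocus F ↔ MvPolynomial.eval v F = 0 := by
  rw [zeroLocus, Set.mem_ofPred_eq, Projectivization.submodule_mk]
  refine ⟨fun h => h v (Submodule.mem_span_singleton_self v), fun h w hw => ?_⟩
  obtain ⟨c, rfl⟩ := Submodule.mem_span_singleton.mp hw
  rw [eval_smul_of_isHomogeneous hF, h, mul_zero]

/-- A cubic form that is invariant under translation by a non-zero vector defines a cone. -/
theorem isCone_of_translation_invariant (hf : f.IsHomogeneous 3) {w : Fin n → K} (hw : w ≠ 0)
    (h : ∀ (v : Fin n → K) (c : K),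
      MvPolynomial.eval (v + c • w) f = MvPolynomial.eval v f) : IsCone (zeroLocus f) := by
  have h0 : MvPolynomial.eval (0 : Fin n → K) f = 0 := by
    simpa using eval_smul_of_isHomogeneous hf 0 (0 : Fin n → K)
  refine ⟨Projectivization.mk K w hw, (mk_mem_zeroLocus hf hw).mpr ?_, fun q hq r hr => ?_⟩
  · have h1 := h 0 1
    rwa [one_smul, zero_add, h0] at h1
  · intro v hv
    have hv' := hr hv
    rw [Projectivization.submodule_mk, Submodule.mem_sup] at hv'
    obtain ⟨_, hy, z, hz, rfl⟩ := hv'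
    obtain ⟨c, rfl⟩ := Submodule.mem_span_singleton.mp hy
    rw [add_comm, h]
    exact hq z hz

/-- If `T(w,·,·) = 0`, every term of the Taylor expansion in the direction `w` vanishes, so `w`
would span a vertex. By linearity, `w ↦ T(w,·,·)` is injective when `V(f)` is not a cone. -/
theorem eq_zero_of_polar_eq_zero [CharZero K] (hf : f.IsHomogeneous 3)
    (hcone : ¬ IsCone (zeroLocus f)) {w : Fin n → K} (hw : polar f K w = 0) : w = 0 := by
  by_contra hne
  refine hcone (isCone_of_translation_invariant hf hne fun v c => ?_)
  have h1 := eval_add hf v (c • w)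
  rw [polar_dotProduct_comm, polar_comm v (c • w), ← polar_self_self hf (c • w)] at h1
  simp [hw] at h1
  exact h1

end Cubic

/-! ### The rank estimate -/

section Rank

open Module

/-- The rank estimate behind the classification: if `n` is a field of null vectors of the Hessian
matrix at the generic point `x`, with derivatives `d i` and second derivatives `dd i j`, then the
polar quadric of `n` has rank at most one. -/
theorem finrank_range_le_one {L : Type*} [Field L]
    (B : (Fin 5 → L) →ₗ[L] (Fin 5 → L) →ₗ[L] (Fin 5 → L)) (hcomm : ∀ u v, B u v = B v u)
    (hdot : ∀ u v w, B u v ⬝ᵥ w = B u w ⬝ᵥ v) (x n : Fin 5 → L) (d : Fin 5 → Fin 5 → L)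
    (dd : Fin 5 → Fin 5 → Fin 5 → L) (hxn : B x n = 0)
    (hxd : ∀ i, B (Pi.single i 1) n + B x (d i) = 0) (hnn : B n n = 0)
    (hnd : ∀ i, B n (d i) = 0) (hdd : ∀ i j, B (d j) (d i) + B n (dd i j) = 0)
    (hx : B x x ⬝ᵥ x ≠ 0) : finrank L (LinearMap.range (B n)) ≤ 1 := by
  by_cases hn : n = 0
  · subst hn
    rw [map_zero, LinearMap.range_zero, finrank_bot]
    exact zero_le_one
  set D : Submodule L (Fin 5 → L) := Submodule.span L (insert n (Set.range d)) with hD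
  have hnD : n ∈ D := Submodule.subset_span (Set.mem_insert _ _)
  have hdD : ∀ i, d i ∈ D := fun i => Submodule.subset_span (Set.mem_insert_of_mem _ ⟨i, rfl⟩)
  have hker : D ≤ LinearMap.ker (B n) := by
    rw [hD, Submodule.span_le]
    rintro _ (rfl | ⟨i, rfl⟩)
    · exact hnn
    · exact hnd i
  -- The first derivative relation reads `B n eᵢ = -B x dᵢ`.
  have hrange : LinearMap.range (B n) ≤ LinearMap.range ((B x).domRestrict D) := by
    rw [LinearMap.range_eq_map, ← (Pi.basisFun L (Fin 5)).span_eq, Submodule.map_span,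
      Submodule.span_le]
    rintro _ ⟨_, ⟨i, rfl⟩, rfl⟩
    refine ⟨-⟨d i, hdD i⟩, ?_⟩
    rw [map_neg, LinearMap.domRestrict_apply, Pi.basisFun_apply, hcomm n]
    exact neg_eq_of_add_eq_zero_left (hxd i)
  have hpos : 0 < finrank L (LinearMap.ker ((B x).domRestrict D)) := by
    have : Nontrivial (LinearMap.ker ((B x).domRestrict D)) := by
      refine ⟨⟨⟨n, hnD⟩, hxn⟩, 0, fun h => hn ?_⟩
      exact congrArg (fun y : LinearMap.ker ((B x).domRestrict D) => ((y : D) : Fin 5 → L)) h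
    exact Module.finrank_pos (R := L) (M := LinearMap.ker ((B x).domRestrict D))
  have h1 := LinearMap.finrank_range_add_finrank_ker ((B x).domRestrict D)
  have h2 := LinearMap.finrank_range_add_finrank_ker (B n)
  have h3 := Submodule.finrank_mono hrange
  have h4 := Submodule.finrank_mono hker
  rw [finrank_fin_fun] at h2
  -- Let `r` be the rank of `B n`. As `B x` kills `n ∈ D`, `r ≤ dim D - 1 ≤ (5 - r) - 1`, so `r ≤
  -- 2`. It remains to exclude `r = 2`, where equality forces `D = ker (B n)`, which contains `x`.
  by_contra hlt
  have hDker : D = LinearMap.ker (B n) := Submodule.eq_of_le_of_finrank_le hker (by omega)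
  have hxD : x ∈ D := by
    rw [hDker, LinearMap.mem_ker, hcomm, hxn]
  -- By the second derivative relation `B` maps `D × D` into the range of `B n`. With `x ∈ D` this
  -- gives `B x x = B n m`, and pairing with `x` yields zero because `B x n = 0`.
  have hBD : ∀ w ∈ D, ∀ u ∈ D, B u w ∈ LinearMap.range (B n) := by
    have hstep : ∀ w, (∀ u ∈ insert n (Set.range d), B u w ∈ LinearMap.range (B n)) →
        ∀ u ∈ D, B u w ∈ LinearMap.range (B n) := by
      intro w hw u hu
      have : D ≤ (LinearMap.range (B n)).comap (B.flip w) := Submodule.span_le.mpr hw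
      exact this hu
    have hd : ∀ i, ∀ w ∈ D, B w (d i) ∈ LinearMap.range (B n) := by
      intro i
      refine hstep _ ?_
      rintro _ (rfl | ⟨j, rfl⟩)
      · exact ⟨d i, rfl⟩
      · exact ⟨-dd i j, by rw [map_neg]; exact neg_eq_of_add_eq_zero_left (hdd i j)⟩
    intro w hw
    refine hstep _ ?_
    rintro _ (rfl | ⟨i, rfl⟩)
    · exact ⟨w, rfl⟩
    · rw [hcomm]
      exact hd i w hw
  obtain ⟨m, hm⟩ := hBD x hxD x hxD
  apply hx
  rw [← hm, hdot, hcomm, hxn, zero_dotProduct]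

end Rank

/-! ### Null vectors of the Hessian and the singular plane -/

section NullField

variable {K : Type*} [Field K] {f : MvPolynomial (Fin 5) K}

open MvPolynomial in
/-- A cubic form with vanishing hessian has a polynomial vector field `n ≠ 0` of null vectors of
its Hessian matrix, and the polar quadrics of `n` are squares of linear forms. -/
theorem exists_nullField [CharZero K] (hf : f.IsHomogeneous 3) (hf0 : f ≠ 0)
    (hhess : hessian f = 0) :
    ∃ n : Fin 5 → MvPolynomial (Fin 5) K, n ≠ 0 ∧ polar f _ X n = 0 ∧ polar f _ n n = 0 ∧
      ∀ u v i j, polar f _ n u i * polar f _ n v j = polar f _ n u j * polar f _ n v i := by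
  obtain ⟨n, hn, hXn⟩ := Matrix.exists_mulVec_eq_zero_iff.mpr hhess
  rw [← polar_X hf] at hXn
  set d : Fin 5 → Fin 5 → MvPolynomial (Fin 5) K := fun i k => pderiv i (n k) with hd
  set dd : Fin 5 → Fin 5 → Fin 5 → MvPolynomial (Fin 5) K := fun i j k => pderiv j (d i k) with hdd
  have hXd : ∀ i, polar f _ (Pi.single i 1) n + polar f _ X (d i) = 0 := by
    intro i
    have h := pderiv_polar (f := f) i X n
    rw [hXn] at h
    have hs : (fun k => pderiv i (X k : MvPolynomial (Fin 5) K)) = Pi.single i 1 := by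
      ext1 k
      rw [pderiv_X]
    rw [hs] at h
    rw [← h]
    ext1 k
    simp
  -- Pair the differentiated relation with `n`: the term containing `∂ᵢn` dies since `T(x,n,·) = 0`,
  -- leaving `T(n,n,eᵢ) = 0`.
  have hnn : polar f _ n n = 0 := by
    ext1 i
    have h := congrArg (· ⬝ᵥ n) (hXd i)
    simp only [add_dotProduct, zero_dotProduct] at h
    rw [polar_dotProduct_comm X, hXn, zero_dotProduct, add_zero, polar_comm,
      polar_dotProduct_comm] at h
    simpa using h
  have hnd : ∀ i, polar f _ n (d i) = 0 := by
    intro i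
    have h := pderiv_polar (f := f) i n n
    rw [hnn, polar_comm _ n, ← two_smul (MvPolynomial (Fin 5) K)] at h
    have h' : (2 : MvPolynomial (Fin 5) K) • polar f _ n (d i) = 0 := by
      rw [← h]
      ext1 k
      simp
    exact (smul_eq_zero.mp h').resolve_left two_ne_zero
  have hddn : ∀ i j, polar f _ (d j) (d i) + polar f _ n (dd i j) = 0 := by
    intro i j
    have h := pderiv_polar (f := f) j n (d i)
    rw [hnd] at h
    rw [← h]
    ext1 k
    simp
  refine ⟨n, hn, hXn, hnn, ?_⟩
  -- Rank is computed at the generic point, over the fraction field. The resulting vanishing of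
  -- minors is polynomial, so it descends and can be specialised at every point.
  let φ : MvPolynomial (Fin 5) K →ₐ[K] FractionRing (MvPolynomial (Fin 5) K) :=
    IsScalarTower.toAlgHom K _ _
  have hφ : Function.Injective φ := IsFractionRing.injective _ _
  let ι : (Fin 5 → MvPolynomial (Fin 5) K) → Fin 5 → FractionRing (MvPolynomial (Fin 5) K) :=
    fun u k => φ (u k)
  have hι : ∀ u v, polar f (FractionRing (MvPolynomial (Fin 5) K)) (ι u) (ι v) = ι (polar f _ u v) :=
    fun u v => (map_polar φ u v).symm
  have hιadd : ∀ u v, ι u + ι v = ι (u + v) := fun u v => by ext1 k; simp [ι]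
  have hι0 : ι 0 = 0 := by ext1 k; simp [ι]
  have hι1 : ∀ i, Pi.single i 1 = ι (Pi.single i 1) := fun i => by
    ext1 k
    simp [ι, Pi.single_apply, apply_ite]
  have hrank := finrank_range_le_one (polar f (FractionRing (MvPolynomial (Fin 5) K))) polar_comm
    polar_dotProduct_comm
    (ι X) (ι n) (fun i => ι (d i)) (fun i j => ι (dd i j)) (by rw [hι, hXn, hι0])
    (fun i => by rw [hι1, hι, hι, hιadd, hXd, hι0]) (by rw [hι, hnn, hι0])
    (fun i => by rw [hι, hnd, hι0]) (fun i j => by rw [hι, hι, hιadd, hddn, hι0]) (by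
      have h : ι (polar f _ X X) ⬝ᵥ ι X = φ (6 * f) := by
        rw [← polar_X_X_X hf]
        simp [ι, dotProduct]
      rw [hι, h, map_ne_zero_iff φ hφ]
      exact mul_ne_zero (by norm_num) hf0)
  obtain ⟨⟨p, hp⟩, hpr⟩ := finrank_le_one_iff.mp hrank
  intro u v i j
  apply hφ
  obtain ⟨a, ha⟩ := hpr ⟨ι (polar f _ n u), ι u, hι n u⟩
  obtain ⟨b, hb⟩ := hpr ⟨ι (polar f _ n v), ι v, hι n v⟩
  have ha' : ∀ k, a * p k = φ (polar f _ n u k) := fun k =>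
    congrFun (congrArg Subtype.val ha) k
  have hb' : ∀ k, b * p k = φ (polar f _ n v k) := fun k =>
    congrFun (congrArg Subtype.val hb) k
  rw [map_mul, map_mul, ← ha', ← ha', ← hb', ← hb']
  ring

/-- A symmetric matrix of rank at most one over an algebraically closed field is `ℓ ℓᵀ`. -/
theorem exists_eq_mul_of_minors {K : Type*} [Field K] [IsAlgClosed K] {m : ℕ}
    (M : Fin m → Fin m → K)
    (hM : ∀ i j, M i j = M j i) (hmin : ∀ i j k l, M i k * M j l = M i l * M j k) :
    ∃ ℓ : Fin m → K, ∀ i j, M i j = ℓ i * ℓ j := by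
  by_cases h : ∃ i, M i i ≠ 0
  · obtain ⟨i, hi⟩ := h
    obtain ⟨r, hr⟩ := IsAlgClosed.exists_pow_nat_eq (M i i) (n := 2) two_pos
    have hr0 : r ≠ 0 := by
      rintro rfl
      exact hi (by simpa using hr.symm)
    refine ⟨fun j => M i j / r, fun j k => ?_⟩
    have := hmin i j i k
    rw [← hr, hM j i] at this
    field_simp
    linear_combination this
  -- With zero diagonal, `Mᵢⱼ² = Mᵢᵢ Mⱼⱼ = 0`.
  · push Not at h
    refine ⟨0, fun i j => ?_⟩
    have := hmin i j j i
    rw [hM j i, h, h, zero_mul] at this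
    simpa using this

/-- The polar quadric of `w` is the square of the linear form `ℓ`. -/
theorem exists_linearForm [IsAlgClosed K] (w : Fin 5 → K)
    (hmin : ∀ u v i j, polar f K w u i * polar f K w v j = polar f K w u j * polar f K w v i) :
    ∃ ℓ : Fin 5 → K, ∀ u, polar f K w u = (ℓ ⬝ᵥ u) • ℓ := by
  have key : ∀ i j, polar f K w (Pi.single i 1) j = polar f K w (Pi.single j 1) i := fun i j => by
    simpa using polar_dotProduct_comm (f := f) w (Pi.single i 1) (Pi.single j 1)
  obtain ⟨ℓ, hℓ⟩ := exists_eq_mul_of_minors (fun i j => polar f K w (Pi.single i 1) j) key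
    (fun i j k l => hmin _ _ _ _)
  refine ⟨ℓ, fun u => ?_⟩
  ext1 k
  have h := polar_dotProduct_comm (f := f) w u (Pi.single k 1)
  rw [dotProduct_single_one] at h
  rw [h]
  simp only [dotProduct, hℓ, Pi.smul_apply, smul_eq_mul, Finset.sum_mul]
  exact Finset.sum_congr rfl fun i _ => by ring

theorem smul_eq_of_linearForm [CharZero K] (hf : f.IsHomogeneous 3)
    (hcone : ¬ IsCone (zeroLocus f))
    {w w' ℓ ℓ' : Fin 5 → K} (hw : ∀ u, polar f K w u = (ℓ ⬝ᵥ u) • ℓ)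
    (hw' : ∀ u, polar f K w' u = (ℓ' ⬝ᵥ u) • ℓ') {c : K} (h : ℓ = c • ℓ') : w = c ^ 2 • w' := by
  rw [← sub_eq_zero]
  apply eq_zero_of_polar_eq_zero hf hcone
  refine LinearMap.ext fun u => ?_
  rw [map_sub, map_smul, LinearMap.sub_apply, LinearMap.smul_apply, hw, hw', h]
  simp only [smul_dotProduct, smul_smul, smul_eq_mul, LinearMap.zero_apply]
  rw [sub_eq_zero]
  ring_nf

/-- By symmetry `T(w,w',·)` is a multiple of both `ℓ` and `ℓ'`. If it were non-zero, `ℓ` and `ℓ'`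
would be proportional, hence so would `w` and `w'`, against `T(w',w',·) = 0`. -/
theorem polar_eq_zero_of_linearForm [CharZero K] (hf : f.IsHomogeneous 3)
    (hcone : ¬ IsCone (zeroLocus f))
    {w w' ℓ ℓ' : Fin 5 → K} (hw : ∀ u, polar f K w u = (ℓ ⬝ᵥ u) • ℓ)
    (hw' : ∀ u, polar f K w' u = (ℓ' ⬝ᵥ u) • ℓ') (hww' : polar f K w' w' = 0) :
    polar f K w w' = 0 := by
  by_contra h
  have h1 := hw' w
  rw [polar_comm, hw w'] at h1
  have h2 : ℓ ⬝ᵥ w' ≠ 0 := fun h0 => h (by rw [hw, h0, zero_smul])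
  have h3 : ℓ = ((ℓ ⬝ᵥ w')⁻¹ * (ℓ' ⬝ᵥ w)) • ℓ' := by
    rw [mul_smul, ← h1, inv_smul_smul₀ h2]
  rw [smul_eq_of_linearForm hf hcone hw hw' h3, map_smul, LinearMap.smul_apply, hww',
    smul_zero] at h
  exact h rfl

/-- The quadric `pℓ² + qℓ'²` with `ℓ`, `ℓ'` independent has rank one only if a coefficient vanishes.
-/
theorem eq_zero_or_eq_zero_of_linearForm [CharZero K] (hf : f.IsHomogeneous 3)
    (hcone : ¬ IsCone (zeroLocus f)) {w w' w'' ℓ ℓ' ℓ'' : Fin 5 → K}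
    (hw : ∀ u, polar f K w u = (ℓ ⬝ᵥ u) • ℓ) (hw' : ∀ u, polar f K w' u = (ℓ' ⬝ᵥ u) • ℓ')
    (hw'' : ∀ u, polar f K w'' u = (ℓ'' ⬝ᵥ u) • ℓ'') (h0 : w ≠ 0)
    (hspan : w' ∉ Submodule.span K {w}) {p q : K} (h : w'' = p • w + q • w') :
    p = 0 ∨ q = 0 := by
  have hpq : ∀ i j, p * (ℓ i * ℓ j) + q * (ℓ' i * ℓ' j) = ℓ'' i * ℓ'' j := fun i j => by
    have := congrFun (hw'' (Pi.single i 1)) j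
    rw [h, map_add, map_smul, map_smul, LinearMap.add_apply, LinearMap.smul_apply,
      LinearMap.smul_apply, hw, hw'] at this
    simpa using this
  by_contra! hne
  obtain ⟨i, hi⟩ : ∃ i, ℓ i ≠ 0 := by
    by_contra! h1
    refine h0 (eq_zero_of_polar_eq_zero hf hcone (LinearMap.ext fun u => ?_))
    rw [hw, show ℓ = 0 from funext h1, smul_zero, LinearMap.zero_apply]
  have hκ : ℓ' = (ℓ' i / ℓ i) • ℓ := by
    ext1 j
    -- The left side is the principal `(i,j)` minor of the matrix of `pℓ² + qℓ'²`, which vanishes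
    -- because this quadric is `ℓ''²`.
    have h1 : p * q * (ℓ i * ℓ' j - ℓ j * ℓ' i) ^ 2 = 0 := by
      linear_combination (q * ℓ' j ^ 2 + p * ℓ j ^ 2) * hpq i i + ℓ'' i ^ 2 * hpq j j -
        (p * (ℓ i * ℓ j) + q * (ℓ' i * ℓ' j) + ℓ'' i * ℓ'' j) * hpq i j
    have h2 := pow_eq_zero_iff (two_ne_zero) |>.mp
      ((mul_eq_zero.mp h1).resolve_left (mul_ne_zero hne.1 hne.2))
    rw [Pi.smul_apply, smul_eq_mul]
    field_simp
    linear_combination h2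
  exact hspan (Submodule.mem_span_singleton.mpr
    ⟨_, (smul_eq_of_linearForm hf hcone hw' hw hκ).symm⟩)

open Module in
/-- A cubic form in five variables with vanishing hessian, not defining a cone, is singular along
a plane, in the strong sense that the polar map kills pairs of vectors of the plane. -/
theorem exists_plane [IsAlgClosed K] [CharZero K] (hf : f.IsHomogeneous 3) (hf0 : f ≠ 0)
    (hhess : hessian f = 0) (hcone : ¬ IsCone (zeroLocus f)) :
    ∃ W : Submodule K (Fin 5 → K), finrank K W = 3 ∧ ∀ u ∈ W, ∀ v ∈ W, polar f K u v = 0 := by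
  obtain ⟨n, hn, hXn, hnn, hmin⟩ := exists_nullField hf hf0 hhess
  let ev (a : Fin 5 → K) : MvPolynomial (Fin 5) K →ₐ[K] K := MvPolynomial.aeval a
  let w : (Fin 5 → K) → Fin 5 → K := fun a k => ev a (n k)
  have hev : ∀ a (u v : Fin 5 → MvPolynomial (Fin 5) K),
      polar f K (fun k => ev a (u k)) (fun k => ev a (v k)) = fun k => ev a (polar f _ u v k) :=
    fun a u v => (map_polar (ev a) u v).symm
  have haw : ∀ a, polar f K a (w a) = 0 := fun a => by
    have := hev a MvPolynomial.X n
    simp only [ev, MvPolynomial.aeval_X] at this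
    change polar f K a (w a) = _ at this
    rw [this, hXn]
    ext1 k
    simp
  have hww : ∀ a, polar f K (w a) (w a) = 0 := fun a => by
    rw [hev a n n, hnn]
    ext1 k
    simp
  have hℓ : ∀ a, ∃ ℓ : Fin 5 → K, ∀ u, polar f K (w a) u = (ℓ ⬝ᵥ u) • ℓ := fun a => by
    refine exists_linearForm _ fun u v i j => ?_
    have hu := hev a n (fun k => MvPolynomial.C (u k))
    have hv := hev a n (fun k => MvPolynomial.C (v k))
    simp only [ev, MvPolynomial.aeval_C, Algebra.algebraMap_self, RingHom.id_apply] at hu hv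
    change polar f K (w a) u = _ at hu
    change polar f K (w a) v = _ at hv
    rw [hu, hv, ← map_mul, ← map_mul, hmin]
  choose ℓ hℓ using hℓ
  have hw2 : ∀ a b, polar f K (w a) (w b) = 0 := fun a b =>
    polar_eq_zero_of_linearForm hf hcone (hℓ a) (hℓ b) (hww b)
  set S := Submodule.span K (Set.range w) with hS
  have hSS : ∀ u ∈ S, ∀ v ∈ S, polar f K u v = 0 := by
    intro u hu v hv
    have h1 : ∀ a, S ≤ LinearMap.ker ((polar f K).flip (w a)) := fun a => by
      rw [hS, Submodule.span_le]
      rintro _ ⟨b, rfl⟩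
      exact hw2 b a
    have h2 : S ≤ LinearMap.ker (polar f K u) := by
      rw [hS, Submodule.span_le]
      rintro _ ⟨b, rfl⟩
      exact h1 b hu
    exact h2 hv
  suffices h3 : 3 ≤ finrank K S by
    obtain ⟨b, hb⟩ := exists_linearIndependent_of_le_finrank h3
    have hb' : LinearIndependent K (fun i => (b i : Fin 5 → K)) :=
      hb.map' S.subtype S.ker_subtype
    have hbS : Submodule.span K (Set.range fun i => (b i : Fin 5 → K)) ≤ S := by
      rw [Submodule.span_le]
      rintro _ ⟨i, rfl⟩
      exact (b i).2
    exact ⟨_, by rw [finrank_span_eq_card hb', Fintype.card_fin],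
      fun u hu v hv => hSS u (hbS hu) v (hbS hv)⟩
  obtain ⟨a, ha⟩ : ∃ a, w a ≠ 0 := by
    by_contra! h
    refine hn (funext fun k => MvPolynomial.funext fun a => ?_)
    simpa [w, ev, MvPolynomial.aeval_eq_eval] using congrFun (h a) k
  -- Otherwise `n` is everywhere a multiple of the constant vector `w a`, so `T(x, w a, ·) = 0`
  -- wherever `n ≠ 0`, hence identically.
  obtain ⟨b, hb⟩ : ∃ b, w b ∉ Submodule.span K {w a} := by
    by_contra! h
    refine ha (eq_zero_of_polar_eq_zero hf hcone (LinearMap.ext fun c => funext fun j => ?_))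
    obtain ⟨k, hk⟩ := Function.ne_iff.mp ha
    set P := polar f _ MvPolynomial.X fun i => MvPolynomial.C (σ := Fin 5) (w a i) with hP
    have hPc : ∀ c j, ev c (P j) = polar f K c (w a) j := fun c j => by
      have := hev c MvPolynomial.X fun i => MvPolynomial.C (w a i)
      simp only [ev, MvPolynomial.aeval_X, MvPolynomial.aeval_C, Algebra.algebraMap_self,
        RingHom.id_apply] at this
      exact (congrFun this j).symm
    have h0 : n k * P j = 0 := MvPolynomial.funext fun c => by
      obtain ⟨r, hr⟩ := Submodule.mem_span_singleton.mp (h c)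
      have h1 := haw c
      rw [← hr, map_smul] at h1
      have h2 : ev c (n k * P j) = 0 := by
        rw [map_mul, hPc, show ev c (n k) = r * w a k from (congrFun hr k).symm]
        have := congrFun h1 j
        simp only [Pi.smul_apply, smul_eq_mul, Pi.zero_apply] at this
        linear_combination w a k * this
      simpa [ev, MvPolynomial.aeval_eq_eval] using h2
    rcases mul_eq_zero.mp h0 with h1 | h1
    · exact absurd (by simp [w, h1]) hk
    · rw [polar_comm, ← hPc, h1, map_zero]
      rfl
  by_contra hlt
  have hind : LinearIndependent K ![w a, w b] := by
    rw [LinearIndependent.pair_iff' ha]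
    exact fun c hc => hb (Submodule.mem_span_singleton.mpr ⟨c, hc⟩)
  have hspan : Submodule.span K (Set.range ![w a, w b]) = S := by
    refine Submodule.eq_of_le_of_finrank_le (Submodule.span_mono ?_) ?_
    · rintro _ ⟨i, rfl⟩
      fin_cases i
      exacts [⟨a, rfl⟩, ⟨b, rfl⟩]
    · rw [finrank_span_eq_card hind, Fintype.card_fin]
      omega
  have hab : w a ∉ Submodule.span K {w b} := fun h => by
    obtain ⟨c, hc⟩ := Submodule.mem_span_singleton.mp h
    have hc0 : c ≠ 0 := by
      rintro rfl
      exact ha (by rw [← hc, zero_smul])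
    exact hb (Submodule.mem_span_singleton.mpr ⟨c⁻¹, by rw [← hc, inv_smul_smul₀ hc0]⟩)
  obtain ⟨φ, hφb, hφa⟩ := Submodule.exists_le_ker_of_notMem hb
  obtain ⟨ψ, hψa, hψb⟩ := Submodule.exists_le_ker_of_notMem hab
  have hφa : φ (w a) = 0 := hφa (Submodule.mem_span_singleton_self _)
  have hψb : ψ (w b) = 0 := hψb (Submodule.mem_span_singleton_self _)
  let Q (χ : (Fin 5 → K) →ₗ[K] K) : MvPolynomial (Fin 5) K :=
    ∑ k, MvPolynomial.C (χ (Pi.single k 1)) * n k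
  have hQ : ∀ χ c, MvPolynomial.eval c (Q χ) = χ (w c) := fun χ c => by
    conv_rhs => rw [← Finset.univ_sum_single (w c)]
    simp only [Q, map_sum, map_mul, MvPolynomial.eval_C]
    refine Finset.sum_congr rfl fun k _ => ?_
    rw [show Pi.single k (w c k) = w c k • (Pi.single k 1 : Fin 5 → K) by
      rw [← Pi.single_smul', smul_eq_mul, mul_one], map_smul, smul_eq_mul, mul_comm]
    rfl
  -- The values of `n` lie on the two lines spanned by `w a` and `w b`, where `ψ`, respectively `φ`,
  -- is the only one of the two forms not forced to vanish. The polynomial ring being a domain, one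
  -- of `φ ∘ n`, `ψ ∘ n` is zero, contrary to its value at `b` or `a`.
  have h0 : Q φ * Q ψ = 0 := MvPolynomial.funext fun c => by
    have hc : w c ∈ S := Submodule.subset_span ⟨c, rfl⟩
    rw [← hspan, Matrix.range_cons, Matrix.range_cons, Matrix.range_empty, Set.union_empty,
      Set.singleton_union, Submodule.mem_span_pair] at hc
    obtain ⟨p, q, hpq⟩ := hc
    rw [map_mul, hQ, hQ, ← hpq, map_zero]
    rcases eq_zero_or_eq_zero_of_linearForm hf hcone (hℓ a) (hℓ b) (hℓ c) ha hb hpq.symm with h | h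
    · simp [h, hψb]
    · simp [h, hφa]
  rcases mul_eq_zero.mp h0 with h | h
  · exact hφb (by rw [← hQ, h, map_zero])
  · exact hψa (by rw [← hQ, h, map_zero])

end NullField

/-! ### Reduction to the canonical cubic -/

section Canonical

variable {K : Type*} [Field K]

theorem canonicalCubic_isHomogeneous : (canonicalCubic K).IsHomogeneous 3 := by
  have hX := fun i => MvPolynomial.isHomogeneous_X K (i : Fin 5)
  have h2 : (2 : MvPolynomial (Fin 5) K).IsHomogeneous 0 := MvPolynomial.isHomogeneous_C (Fin 5) 2
  exact (((hX 0).mul ((hX 3).pow 2)).add (((h2.mul (hX 1)).mul (hX 3)).mul (hX 4))).add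
    ((hX 2).mul ((hX 4).pow 2))

theorem eval_canonicalCubic (v : Fin 5 → K) :
    MvPolynomial.eval v (canonicalCubic K) =
      v 0 * v 3 ^ 2 + 2 * v 1 * v 3 * v 4 + v 2 * v 4 ^ 2 := by
  simp [canonicalCubic]

variable [CharZero K] {f : MvPolynomial (Fin 5) K}

open Module in
/-- A cubic form whose polar map kills pairs of vectors of a plane, and which does not define a
cone, is the canonical one up to a linear change of coordinates. -/
theorem exists_linearEquiv (hf : f.IsHomogeneous 3) (hcone : ¬ IsCone (zeroLocus f))
    {W : Submodule K (Fin 5 → K)} (hW3 : finrank K W = 3)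
    (hW : ∀ u ∈ W, ∀ v ∈ W, polar f K u v = 0) :
    ∃ g : (Fin 5 → K) ≃ₗ[K] (Fin 5 → K),
      ∀ v, MvPolynomial.eval (g v) (canonicalCubic K) = 6 * MvPolynomial.eval v f := by
  obtain ⟨C, hC⟩ := W.exists_isCompl
  have hC2 : finrank K C = 2 := by
    have := Submodule.finrank_add_eq_of_isCompl hC
    rw [hW3, finrank_fin_fun] at this
    omega
  let b : Basis (Fin 2) K C := finBasisOfFinrankEq K C hC2
  let π := W.projection C hC
  let y (i : Fin 2) : (Fin 5 → K) →ₗ[K] K := b.coord i ∘ₗ C.projectionOnto W hC.symm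
  let e (i : Fin 2) : Fin 5 → K := b i
  let T (i j : Fin 2) : (Fin 5 → K) →ₗ[K] K := (dotProductBilin K K) (polar f K (e i) (e j))
  have hT : ∀ i j u, T i j u = polar f K (e i) (e j) ⬝ᵥ u := fun i j u => rfl
  have hdec : ∀ v, v = π v + (y 0 v • e 0 + y 1 v • e 1) := fun v => by
    have h1 := Submodule.projection_add_projection_eq_self hC v
    have h2 := congrArg C.subtype (b.sum_repr (C.projectionOnto W hC.symm v))
    rw [Fin.sum_univ_two, map_add, map_smul, map_smul] at h2
    exact h1.symm.trans (congrArg (π v + ·) h2.symm)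
  -- With `y = y₀e₀ + y₁e₁`, one has `6f(v) = 3T(πv,y,y) + T(y,y,y)`. The entries collect the
  -- coefficients of `y₀²`, `2y₀y₁`, `y₁²`; the mixed terms of the binary cubic `T(y,y,y)` are put
  -- into the first and third.
  let G : (Fin 5 → K) →ₗ[K] (Fin 5 → K) := LinearMap.pi
    ![(3 : K) • T 0 0 ∘ₗ π + T 0 0 (e 0) • y 0 + (3 * T 0 0 (e 1)) • y 1,
      (3 : K) • T 0 1 ∘ₗ π,
      (3 : K) • T 1 1 ∘ₗ π + (3 * T 1 1 (e 0)) • y 0 + T 1 1 (e 1) • y 1,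
      y 0, y 1]
  have hG : ∀ v, MvPolynomial.eval (G v) (canonicalCubic K) = 6 * MvPolynomial.eval v f := by
    intro v
    have hπ : polar f K (π v) (π v) = 0 := hW _ (Submodule.coe_mem _) _ (Submodule.coe_mem _)
    have h1 := eval_add hf (π v) (y 0 v • e 0 + y 1 v • e 1)
    rw [← polar_self_self hf (π v), 
      ← polar_self_self hf (y 0 v • e 0 + y 1 v • e 1), hπ, ← hdec] at h1
    have h01 : T 0 0 (e 1) = T 0 1 (e 0) := polar_dotProduct_comm _ _ _
    have h11 : T 1 1 (e 0) = T 0 1 (e 1) := by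
      rw [hT, hT, polar_dotProduct_comm, polar_comm]
    simp only [map_add, map_smul, LinearMap.add_apply, LinearMap.smul_apply, add_dotProduct,
      smul_dotProduct, dotProduct_add, dotProduct_smul, smul_eq_mul, zero_dotProduct,
      polar_comm (e 1) (e 0), ← hT] at h1
    rw [h1, eval_canonicalCubic]
    simp only [G, LinearMap.pi_apply, Matrix.cons_val, LinearMap.add_apply, LinearMap.smul_apply,
      LinearMap.comp_apply, smul_eq_mul]
    rw [h01, h11]
    ring
  -- `f` factors through `G`, so it is invariant under translation by a kernel vector.
  have hinj : Function.Injective G := by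
    rw [← LinearMap.ker_eq_bot, Submodule.eq_bot_iff]
    intro w hw
    by_contra hw0
    refine hcone (isCone_of_translation_invariant hf hw0 fun v c => ?_)
    have h6 : (6 : K) ≠ 0 := by norm_num
    apply mul_left_cancel₀ h6
    rw [← hG, ← hG, map_add, map_smul, LinearMap.mem_ker.mp hw, smul_zero, add_zero]
  exact ⟨LinearEquiv.ofInjectiveEndo G hinj, hG⟩

end Canonical

/-! ### Behaviour under projective transformations -/

section Transport

variable {K : Type*} [Field K]

section Projective

variable {V : Type*} [AddCommGroup V] [Module K V]

theorem mk_submodule_eq_span_iff {v x : V} (hv : v ≠ 0) :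
    (Projectivization.mk K v hv).submodule = Submodule.span K {x} ↔ ∃ c : K, c ≠ 0 ∧ c • x = v := by
  rw [Projectivization.submodule_mk, eq_comm, Submodule.span_singleton_eq_span_singleton]
  exact ⟨fun ⟨c, hc⟩ => ⟨c, c.ne_zero, hc⟩, fun ⟨c, hc, h⟩ => ⟨Units.mk0 c hc, h⟩⟩

theorem mk_mem_linearSubspace {U : Submodule K V} {v : V} (hv : v ≠ 0) :
    Projectivization.mk K v hv ∈ linearSubspace U ↔ v ∈ U := by
  rw [linearSubspace, Set.mem_ofPred_eq, Projectivization.submodule_mk,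
    Submodule.span_singleton_le_iff_mem]

theorem mk_mem_map_image (g : V ≃ₗ[K] V) {S : Set (ℙ K V)} {v : V} (hv : v ≠ 0) :
    Projectivization.mk K v hv ∈ Projectivization.map g.toLinearMap g.injective '' S ↔
      Projectivization.mk K (g.symm v) (by simpa using hv) ∈ S := by
  conv_rhs => rw [← (Projectivization.map_injective g.toLinearMap g.injective).mem_set_image,
    Projectivization.map_mk]
  simp only [LinearEquiv.coe_coe, LinearEquiv.apply_symm_apply]

theorem ProjectivelyEquivalent.symm {X Y : Set (ℙ K V)} (h : ProjectivelyEquivalent X Y) :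
    ProjectivelyEquivalent Y X := by
  obtain ⟨g, rfl⟩ := h
  refine ⟨g.symm, Set.ext fun p => ?_⟩
  induction p using Projectivization.ind with
  | h v hv =>
    rw [mk_mem_map_image, mk_mem_map_image]
    simp only [LinearEquiv.symm_symm, LinearEquiv.symm_apply_apply]

theorem ProjectivelyEquivalent.trans {X Y Z : Set (ℙ K V)} (h : ProjectivelyEquivalent X Y)
    (h' : ProjectivelyEquivalent Y Z) : ProjectivelyEquivalent X Z := by
  obtain ⟨g, rfl⟩ := h
  obtain ⟨g', rfl⟩ := h'
  refine ⟨g.trans g', Set.ext fun p => ?_⟩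
  induction p using Projectivization.ind with
  | h v hv =>
    rw [mk_mem_map_image, mk_mem_map_image, mk_mem_map_image]
    rfl

end Projective

variable {n : ℕ}

theorem mk_mem_zariskiClosure {S : Set (ℙ K (Fin n → K))} {v : Fin n → K} (hv : v ≠ 0) :
    Projectivization.mk K v hv ∈ zariskiClosure S ↔
      ∀ (d : ℕ) (F : MvPolynomial (Fin n) K), F.IsHomogeneous d →
        (∀ w hw, Projectivization.mk K w hw ∈ S → MvPolynomial.eval w F = 0) →
          MvPolynomial.eval v F = 0 := by
  refine forall₃_congr fun d F hF => ?_
  rw [mk_mem_zeroLocus hF]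
  refine imp_congr_left ⟨fun h w hw hS => (mk_mem_zeroLocus hF hw).mp (h hS), fun h p => ?_⟩
  induction p using Projectivization.ind with
  | h w hw => exact fun hS => (mk_mem_zeroLocus hF hw).mpr (h w hw hS)

theorem exists_comp_isHomogeneous (g : (Fin n → K) →ₗ[K] (Fin n → K)) {d : ℕ}
    {F : MvPolynomial (Fin n) K} (hF : F.IsHomogeneous d) :
    ∃ G : MvPolynomial (Fin n) K, G.IsHomogeneous d ∧
      ∀ v, MvPolynomial.eval v G = MvPolynomial.eval (g v) F := by
  refine ⟨MvPolynomial.aeval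
    (fun i => ∑ j, MvPolynomial.C (g (Pi.single j 1) i) * MvPolynomial.X j) F, ?_, fun v => ?_⟩
  · have := hF.aeval (fun i => ∑ j, MvPolynomial.C (g (Pi.single j 1) i) * MvPolynomial.X j)
      (n := 1) fun i => MvPolynomial.IsHomogeneous.sum _ _ _ fun j _ =>
        MvPolynomial.isHomogeneous_C_mul_X _ _
    rwa [one_mul] at this
  · rw [← MvPolynomial.aeval_eq_eval, ← MvPolynomial.aeval_eq_eval]
    rw [← AlgHom.comp_apply, MvPolynomial.comp_aeval]
    congr 2
    ext1 i
    simp only [map_sum, map_mul, MvPolynomial.aeval_C, MvPolynomial.aeval_X,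
      Algebra.algebraMap_self, RingHom.id_apply]
    conv_rhs => rw [← LinearMap.toMatrix'_mulVec g v]
    simp only [Matrix.mulVec, dotProduct, LinearMap.toMatrix'_apply]

theorem ProjectivelyEquivalent.zariskiClosure {S T : Set (ℙ K (Fin n → K))}
    (h : ProjectivelyEquivalent S T) :
    ProjectivelyEquivalent (zariskiClosure S) (zariskiClosure T) := by
  have key : ∀ (g : (Fin n → K) ≃ₗ[K] (Fin n → K)) (S T : Set (ℙ K (Fin n → K))),
      (∀ w hw, Projectivization.mk K w hw ∈ S →
        Projectivization.mk K (g w) (by simpa using hw) ∈ T) → ∀ v hv,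
      Projectivization.mk K v hv ∈ CubicP4.zariskiClosure S →
        Projectivization.mk K (g v) (by simpa using hv) ∈ CubicP4.zariskiClosure T := by
    intro g S T hST v hv h
    rw [mk_mem_zariskiClosure] at h ⊢
    intro d F hF hT
    obtain ⟨G, hG, hGF⟩ := exists_comp_isHomogeneous g.toLinearMap hF
    exact (hGF v).symm.trans
      (h d G hG fun w hw hS => (hGF w).trans (hT _ _ (hST w hw hS)))
  obtain ⟨g, rfl⟩ := h
  refine ⟨g, Set.ext fun p => ?_⟩
  induction p using Projectivization.ind with
  | h v hv =>
    rw [mk_mem_map_image]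
    refine ⟨fun h => ?_, key g.symm _ _ (fun w hw hS => (mk_mem_map_image g hw).mp hS) v hv⟩
    have := key g S (Projectivization.map g.toLinearMap g.injective '' S)
      (fun w hw hS => (mk_mem_map_image g _).mpr (by simpa using hS)) _ _ h
    simpa using this

theorem projectivelyEquivalent_zeroLocus {d e : ℕ} {f h : MvPolynomial (Fin n) K}
    (hf : f.IsHomogeneous d) (hh : h.IsHomogeneous e) {g : (Fin n → K) ≃ₗ[K] (Fin n → K)} {c : K}
    (hc : c ≠ 0) (hg : ∀ v, MvPolynomial.eval (g v) h = c * MvPolynomial.eval v f) :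
    Projectivization.map g.toLinearMap g.injective '' zeroLocus f = zeroLocus h := by
  ext p
  induction p using Projectivization.ind with
  | h v hv =>
    have := hg (g.symm v)
    rw [g.apply_symm_apply] at this
    rw [mk_mem_map_image, mk_mem_zeroLocus hf, mk_mem_zeroLocus hh, this, mul_eq_zero,
      or_iff_right hc]

theorem exists_transpose (g : (Fin n → K) ≃ₗ[K] (Fin n → K)) :
    ∃ g' : (Fin n → K) ≃ₗ[K] (Fin n → K), ∀ u w, g' u ⬝ᵥ w = u ⬝ᵥ g w := by
  refine ⟨dotProductEquiv K (Fin n) ≪≫ₗ g.dualMap ≪≫ₗ (dotProductEquiv K (Fin n)).symm,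
    fun u w => ?_⟩
  rw [← dotProductEquiv_apply_apply (R := K)]
  simp

theorem mk_mem_singularLocus {f : MvPolynomial (Fin n) K} (hf : f.IsHomogeneous 3)
    {v : Fin n → K} (hv : v ≠ 0) :
    Projectivization.mk K v hv ∈ singularLocus f ↔ gradient f v = 0 := by
  rw [funext_iff]
  exact forall_congr' fun i => mk_mem_zeroLocus hf.pderiv hv

theorem mk_mem_gaussImage {f : MvPolynomial (Fin n) K} (hf : f.IsHomogeneous 3)
    {u : Fin n → K} (hu : u ≠ 0) :
    Projectivization.mk K u hu ∈ gaussImage f ↔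
      ∃ v, MvPolynomial.eval v f = 0 ∧ ∃ c : K, c ≠ 0 ∧ c • gradient f v = u := by
  constructor
  · rintro ⟨p, hp, v, hv, -, h⟩
    exact ⟨v, hp v hv, (mk_submodule_eq_span_iff hu).mp h⟩
  · rintro ⟨v, hfv, c, hc, h⟩
    have hgrad : gradient f v ≠ 0 := by
      rintro h0
      exact hu (by rw [← h, h0, smul_zero])
    have hv : v ≠ 0 := by
      rintro rfl
      refine hgrad (funext fun i => ?_)
      simpa [gradient] using eval_smul_of_isHomogeneous (hf.pderiv (i := i)) 0 (0 : Fin n → K)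
    exact ⟨Projectivization.mk K v hv, (mk_mem_zeroLocus hf hv).mpr hfv, v,
      by simp [Projectivization.submodule_mk], hgrad, (mk_submodule_eq_span_iff hu).mpr ⟨c, hc, h⟩⟩

variable [CharZero K] {f h : MvPolynomial (Fin n) K}

theorem gradient_dotProduct_of_equiv (hf : f.IsHomogeneous 3) (hh : h.IsHomogeneous 3)
    {g : (Fin n → K) ≃ₗ[K] (Fin n → K)} {c : K}
    (hg : ∀ v, MvPolynomial.eval (g v) h = c * MvPolynomial.eval v f) (v w : Fin n → K) :
    gradient h (g v) ⬝ᵥ g w = c * (gradient f v ⬝ᵥ w) := by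
  have h1 := gradient_dotProduct hf v w
  have h2 := gradient_dotProduct hh (g v) (g w)
  rw [← map_add, ← map_sub, hg, hg, hg] at h2
  apply mul_left_cancel₀ (two_ne_zero (α := K))
  linear_combination h2 - c * h1

/-- Gradients transform contragrediently: the transpose of `g` carries the Gauss image of `h` to
that of `f`. -/
theorem projectivelyEquivalent_gaussImage (hf : f.IsHomogeneous 3) (hh : h.IsHomogeneous 3)
    {g : (Fin n → K) ≃ₗ[K] (Fin n → K)} {c : K} (hc : c ≠ 0)
    (hg : ∀ v, MvPolynomial.eval (g v) h = c * MvPolynomial.eval v f) :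
    ProjectivelyEquivalent (gaussImage f) (gaussImage h) := by
  obtain ⟨g', hg'⟩ := exists_transpose g
  have hgrad : ∀ v, g' (gradient h (g v)) = c • gradient f v := fun v => by
    refine dotProduct_eq _ _ fun w => ?_
    rw [hg', gradient_dotProduct_of_equiv hf hh hg, smul_dotProduct, smul_eq_mul]
  refine ProjectivelyEquivalent.symm ⟨g', Set.ext fun p => ?_⟩
  induction p using Projectivization.ind with
  | h u hu =>
    rw [mk_mem_map_image, mk_mem_gaussImage hh, mk_mem_gaussImage hf]
    constructor
    · rintro ⟨v, hv, a, ha, hu⟩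
      refine ⟨g.symm v, ?_, a * c, mul_ne_zero ha hc, ?_⟩
      · have := hg (g.symm v)
        rw [g.apply_symm_apply, hv] at this
        exact (mul_eq_zero.mp this.symm).resolve_left hc
      · rw [mul_smul, ← hgrad, g.apply_symm_apply, ← map_smul, hu, g'.apply_symm_apply]
    · rintro ⟨v, hv, a, ha, hu⟩
      refine ⟨g v, by rw [hg, hv, mul_zero], a / c, div_ne_zero ha hc, ?_⟩
      rw [g'.eq_symm_apply, map_smul, hgrad, smul_smul, div_mul_cancel₀ _ hc, hu]

end Transport

/-! ### The canonical cubic: dual scroll, Segre projection, singular plane -/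

section Model

variable {K : Type*} [Field K]

theorem gradient_canonicalCubic (v : Fin 5 → K) :
    gradient (canonicalCubic K) v = ![v 3 ^ 2, 2 * v 3 * v 4, v 4 ^ 2,
      2 * (v 0 * v 3 + v 1 * v 4), 2 * (v 1 * v 3 + v 2 * v 4)] := by
  have h2 : ∀ i : Fin 5, MvPolynomial.pderiv i (2 : MvPolynomial (Fin 5) K) = 0 :=
    fun i => MvPolynomial.pderiv_C (a := (2 : K))
  ext1 i
  fin_cases i <;>
    simp [gradient, canonicalCubic, MvPolynomial.pderiv_X, h2] <;> ring

/-- The points of the cubic scroll off its directrix line. -/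
def openScroll (K : Type*) [Field K] : Set (ℙ K (Fin 5 → K)) :=
  {p | ∃ s t a : K, (s ≠ 0 ∨ t ≠ 0) ∧
    p.submodule = Submodule.span K {![a * s, a * t, s ^ 2, s * t, t ^ 2]}}

/-- The change of dual coordinates from the dual of the canonical cubic to the scroll. -/
noncomputable def scrollCoordinates [CharZero K] : (Fin 5 → K) ≃ₗ[K] (Fin 5 → K) where
  toFun y := ![y 4 / 2, -(y 3 / 2), y 0, y 1 / 2, y 2]
  invFun z := ![z 2, 2 * z 3, z 4, -(2 * z 1), 2 * z 0]
  map_add' y y' := by ext i; fin_cases i <;> simp <;> ring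
  map_smul' c y := by ext i; fin_cases i <;> simp <;> ring
  left_inv y := by ext i; fin_cases i <;> simp <;> ring
  right_inv y := by ext i; fin_cases i <;> simp [neg_div]

theorem projectivelyEquivalent_gaussImage_canonicalCubic [CharZero K] :
    ProjectivelyEquivalent (gaussImage (canonicalCubic K)) (openScroll K) := by
  refine ProjectivelyEquivalent.symm ⟨scrollCoordinates.symm, Set.ext fun p => ?_⟩
  induction p using Projectivization.ind with
  | h u hu =>
    rw [mk_mem_map_image, mk_mem_gaussImage canonicalCubic_isHomogeneous]
    simp only [LinearEquiv.symm_symm, openScroll, Set.mem_ofPred_eq, mk_submodule_eq_span_iff]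
    constructor
    · rintro ⟨s, t, a, hst, c, hc, h⟩
      -- The cubic is the quadratic form of the symmetric matrix `(x y; y z)` at `(s,t)`. Sending
      -- `(s,t)` to the orthogonal vector `(-at, as)` makes it vanish and prescribes the last two
      -- partials.
      obtain ⟨x, y, z, hxy, hyz⟩ : ∃ x y z : K, x * s + y * t = -(a * t) ∧ y * s + z * t = a * s := by
        by_cases hs : s = 0
        · have ht : t ≠ 0 := hst.resolve_left (not_not.mpr hs)
          exact ⟨0, -a, 0, by ring, by rw [hs]; ring⟩
        · exact ⟨-(2 * a * t) / s, a, 0, by field_simp; ring, by ring⟩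
      refine ⟨![x, y, z, s, t], ?_, c, hc, ?_⟩
      · rw [eval_canonicalCubic]
        simp only [Matrix.cons_val]
        linear_combination s * hxy + t * hyz
      · rw [eq_comm, ← LinearEquiv.eq_symm_apply] at h
        rw [h, map_smul, gradient_canonicalCubic]
        congr 1
        ext i
        fin_cases i <;> simp [scrollCoordinates, hxy, hyz]
        ring
    · rintro ⟨v, hv, c, hc, rfl⟩
      rw [eval_canonicalCubic] at hv
      have h34 : v 3 ≠ 0 ∨ v 4 ≠ 0 := by
        by_contra! h
        refine hu ?_
        rw [gradient_canonicalCubic, h.1, h.2]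
        ext i
        fin_cases i <;> simp
      -- The equation of the cubic says that `(v₀v₃ + v₁v₄, v₁v₃ + v₂v₄)` is orthogonal to `(v₃,v₄)
      -- ≠ 0`, hence a multiple of `(-v₄,v₃)`.
      obtain ⟨a, ha, ha'⟩ : ∃ a, v 1 * v 3 + v 2 * v 4 = a * v 3 ∧
          v 0 * v 3 + v 1 * v 4 = -(a * v 4) := by
        by_cases h3 : v 3 = 0
        · have h4 := h34.resolve_left (not_not.mpr h3)
          refine ⟨-v 1, ?_, by rw [h3]; ring⟩
          rw [h3] at hv ⊢
          apply mul_right_cancel₀ h4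
          linear_combination hv
        · refine ⟨(v 1 * v 3 + v 2 * v 4) / v 3, by field_simp, ?_⟩
          field_simp
          linear_combination hv
      refine ⟨v 3, v 4, a, h34, c, hc, ?_⟩
      rw [map_smul, gradient_canonicalCubic, ha, ha']
      congr 1
      ext i
      fin_cases i <;> simp [scrollCoordinates, neg_div, mul_assoc]

/-- The hypotheses are the 2×2 minors of the matrix with rows `(u₀,u₂,u₃)` and `(u₁,u₃,u₄)`, which
cut out the scroll. -/
theorem exists_scroll_parameters {u : Fin 5 → K} (hu : u ≠ 0) (h1 : u 0 * u 3 = u 1 * u 2)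
    (h2 : u 0 * u 4 = u 1 * u 3) (h3 : u 2 * u 4 = u 3 * u 3) :
    ∃ s t a b : K, (s ≠ 0 ∨ t ≠ 0) ∧ (a ≠ 0 ∨ b ≠ 0) ∧
      ∃ c : K, c ≠ 0 ∧ c • ![a * s, a * t, b * s ^ 2, b * (s * t), b * t ^ 2] = u := by
  by_cases hu2 : u 2 = 0
  · have hu3 : u 3 = 0 := by simpa [hu2] using h3.symm
    by_cases hu4 : u 4 = 0
    · refine ⟨u 0, u 1, 1, 0, ?_, Or.inl one_ne_zero, 1, one_ne_zero, ?_⟩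
      · by_contra! h
        refine hu (funext fun i => ?_)
        fin_cases i <;> simp [*]
      · ext i
        fin_cases i <;> simp [*]
    · have hu0 : u 0 = 0 := by simpa [hu3, hu4] using h2
      refine ⟨0, 1, u 1, u 4, Or.inr one_ne_zero, Or.inr hu4, 1, one_ne_zero, ?_⟩
      ext i
      fin_cases i <;> simp [*]
  · refine ⟨u 2, u 3, u 0, 1, Or.inl hu2, Or.inr one_ne_zero, (u 2)⁻¹, inv_ne_zero hu2, ?_⟩
    ext i
    fin_cases i <;> simp <;> field_simp
    · linear_combination h1
    · linear_combination -h3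

theorem minor_eq_of_mem_closure {u : Fin 5 → K} (hu : u ≠ 0)
    (h : Projectivization.mk K u hu ∈ zariskiClosure (openScroll K)) {i j k l : Fin 5}
    (hijkl : ∀ s t a : K, ∀ w : Fin 5 → K, w = ![a * s, a * t, s ^ 2, s * t, t ^ 2] →
      w i * w j = w k * w l) : u i * u j = u k * u l := by
  have hX := fun i => MvPolynomial.isHomogeneous_X K (i : Fin 5)
  have hF : (.X i * .X j - .X k * .X l : MvPolynomial (Fin 5) K).IsHomogeneous (1 + 1) :=
    ((hX i).mul (hX j)).sub ((hX k).mul (hX l))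
  suffices h0 : MvPolynomial.eval u (.X i * .X j - .X k * .X l) = 0 by
    simpa only [map_sub, map_mul, MvPolynomial.eval_X, sub_eq_zero] using h0
  refine (mk_mem_zariskiClosure hu).mp h _ _ hF ?_
  rintro w hw ⟨s, t, a, -, hsta⟩
  obtain ⟨c, -, hc⟩ := (mk_submodule_eq_span_iff hw).mp hsta
  have hq := hijkl s t a _ rfl
  generalize ![a * s, a * t, s ^ 2, s * t, t ^ 2] = q at hc hq
  subst hc
  simp only [map_sub, map_mul, MvPolynomial.eval_X, Pi.smul_apply, smul_eq_mul]
  linear_combination c ^ 2 * hq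

theorem zariskiClosure_openScroll [Infinite K] :
    zariskiClosure (openScroll K) = cubicScroll K := by
  ext p
  induction p using Projectivization.ind with
  | h u hu =>
    rw [cubicScroll, Set.mem_ofPred_eq]
    simp only [mk_submodule_eq_span_iff]
    constructor
    · intro h
      refine exists_scroll_parameters hu ?_ ?_ ?_ <;>
      · refine minor_eq_of_mem_closure hu h fun s t a w hw => ?_
        simp only [hw, Matrix.cons_val]
        ring
    · rintro ⟨s, t, a, b, hst, hab, c, hc, rfl⟩
      rw [mk_mem_zariskiClosure]
      intro d F hF h
      rw [eval_smul_of_isHomogeneous hF]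
      let q (b : K) : Fin 5 → K := ![a * s, a * t, b * s ^ 2, b * (s * t), b * t ^ 2]
      have hq : ∀ b : K, b ≠ 0 → MvPolynomial.eval (q b) F = 0 := by
        intro b hb
        have hqb : q b = b • ![a / b * s, a / b * t, s ^ 2, s * t, t ^ 2] := by
          ext i
          fin_cases i <;> simp [q] <;> field_simp
        have hq0 : q b ≠ 0 := by
          intro h0
          rcases hst with hs | ht
          · simpa [q, hb, hs] using congrFun h0 2
          · simpa [q, hb, ht] using congrFun h0 4
        refine h _ hq0 ⟨s, t, a / b, hst, ?_⟩
        exact (mk_submodule_eq_span_iff hq0).mpr ⟨b, hb, hqb.symm⟩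
      -- Restriction of `F` to a ruling line: it vanishes for all `b ≠ 0`, hence also at the point
      -- `b = 0` of the directrix.
      let P : Polynomial K := MvPolynomial.aeval
        (![.C (a * s), .C (a * t), .X * .C (s ^ 2), .X * .C (s * t), .X * .C (t ^ 2)]) F
      have hP : ∀ b, P.eval b = MvPolynomial.eval (q b) F := by
        intro b
        rw [← Polynomial.coe_aeval_eq_eval, ← MvPolynomial.aeval_eq_eval]
        simp only [P]
        rw [← AlgHom.comp_apply, MvPolynomial.comp_aeval]
        congr 2
        ext i
        fin_cases i <;> simp [q]
      have hP0 : P = 0 := by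
        refine Polynomial.eq_zero_of_infinite_isRoot P (Set.Infinite.mono ?_
          (Set.finite_singleton (0 : K)).infinite_compl)
        intro b hb
        exact (hP b).trans (hq b hb)
      change _ * MvPolynomial.eval (q b) F = 0
      rw [← hP, hP0, Polynomial.eval_zero, mul_zero]

/-- A linear projection whose restriction to the Segre variety parametrizes the canonical cubic. -/
def segreProjection (K : Type*) [Field K] : Matrix (Fin 2) (Fin 3) K →ₗ[K] (Fin 5 → K) where
  toFun M := ![2 * M 1 0, -(M 0 0 + M 1 1), 2 * M 0 1, M 0 2, M 1 2]
  map_add' M N := by ext i; fin_cases i <;> simp <;> ring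
  map_smul' c M := by ext i; fin_cases i <;> simp <;> ring

/-- A point of the cubic is a binary quadratic form `v₀X² + 2v₁XY + v₂Y²` with a zero at `(v₃,v₄)`.
The parametrization is the factorization `2(tX - sY)(b₀X - b₁Y)` with `(v₃,v₄) = b₂(s,t)`. If `v₃ =
v₄ = 0`, a root must be found, whence the algebraically closed field. -/
theorem exists_segreProjection_eq [IsAlgClosed K] [CharZero K] {v : Fin 5 → K}
    (hv : MvPolynomial.eval v (canonicalCubic K) = 0) :
    ∃ (a : Fin 2 → K) (b : Fin 3 → K), segreProjection K (Matrix.vecMulVec a b) = v := by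
  rw [eval_canonicalCubic] at hv
  suffices h : ∃ s t b₀ b₁ b₂ : K, 2 * (t * b₀) = v 0 ∧ -(s * b₀ + t * b₁) = v 1 ∧
      2 * (s * b₁) = v 2 ∧ s * b₂ = v 3 ∧ t * b₂ = v 4 by
    obtain ⟨s, t, b₀, b₁, b₂, h⟩ := h
    refine ⟨![s, t], ![b₀, b₁, b₂], funext fun i => ?_⟩
    fin_cases i <;> simp [segreProjection, ← h]
  by_cases h3 : v 3 = 0
  · by_cases h4 : v 4 = 0
    · by_cases h0 : v 0 = 0
      · exact ⟨1, 0, -v 1, v 2 / 2, 0, by simp [h0], by ring, by ring, by simp [h3], by simp [h4]⟩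
      · obtain ⟨r, hr⟩ := IsAlgClosed.exists_pow_nat_eq (v 1 ^ 2 - v 0 * v 2) (n := 2) two_pos
        refine ⟨(-v 1 + r) / v 0, 1, v 0 / 2, (-v 1 - r) / 2, 0, by ring, by field_simp; ring, ?_,
          by simp [h3], by simp [h4]⟩
        field_simp
        linear_combination -hr
    · have h2 : v 2 = 0 := by simpa [h3, h4] using hv
      exact ⟨0, v 4, v 0 / (2 * v 4), -v 1 / v 4, 1, by field_simp, by field_simp; ring,
        by simp [h2], by simp [h3], by ring⟩
  · refine ⟨v 3, v 4, -(v 1 + v 4 * (v 2 / (2 * v 3))) / v 3, v 2 / (2 * v 3), 1, ?_,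
      by field_simp; ring, by field_simp, by ring, by ring⟩
    field_simp
    linear_combination -hv

theorem isExternalProjection_canonicalCubic [IsAlgClosed K] [CharZero K] :
    IsExternalProjection (segreVariety K) (zeroLocus (canonicalCubic K)) := by
  -- This matrix spans the kernel of the projection; it has rank two, so it lies off the Segre
  -- variety.
  have hp : (!![1, 0, 0; 0, -1, 0] : Matrix (Fin 2) (Fin 3) K) ≠ 0 := fun h => by
    simpa using congrFun (congrFun h 0) 0
  refine ⟨Projectivization.mk K _ hp, ?_, segreProjection K, fun v => ?_, ?_, Set.ext fun x => ?_⟩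
  · rintro ⟨a, b, -, -, h⟩
    obtain ⟨c, hc, h⟩ := (mk_submodule_eq_span_iff hp).mp h
    have h' : ∀ i j, c * (a i * b j) = (!![1, 0, 0; 0, -1, 0] : Matrix (Fin 2) (Fin 3) K) i j :=
      fun i j => congrFun (congrFun h i) j
    have h00 : c * (a 0 * b 0) = 1 := h' 0 0
    have h11 : c * (a 1 * b 1) = -1 := h' 1 1
    have h01 : c * (a 0 * b 1) = 0 := h' 0 1
    have : (1 : K) = 0 := by
      linear_combination (c * a 1 * b 1) * h00 + h11 - c * a 1 * b 0 * h01
    exact one_ne_zero this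
  · refine ⟨!![-v 1, v 2 / 2, v 3; v 0 / 2, 0, v 4], funext fun i => ?_⟩
    fin_cases i <;> simp [segreProjection] <;> ring
  · rw [Projectivization.submodule_mk]
    ext M
    rw [LinearMap.mem_ker, Submodule.mem_span_singleton, funext_iff]
    simp only [segreProjection, LinearMap.coe_mk, AddHom.coe_mk, Fin.forall_fin_succ]
    constructor
    · intro h
      simp at h
      obtain ⟨h10, h00, h01, h02, h12⟩ := h
      refine ⟨M 0 0, ?_⟩
      ext i j
      fin_cases i <;> fin_cases j <;> simp [*]
      linear_combination h00
    · rintro ⟨c, rfl⟩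
      simp
  · induction x using Projectivization.ind with
    | h v hv =>
      rw [mk_mem_zeroLocus canonicalCubic_isHomogeneous]
      constructor
      · intro h
        obtain ⟨a, b, rfl⟩ := exists_segreProjection_eq h
        have hab : Matrix.vecMulVec a b ≠ 0 := fun h0 => hv (by rw [h0, map_zero])
        refine ⟨Projectivization.mk K _ hab, ⟨a, b, ?_, ?_, Projectivization.submodule_mk _ _⟩, ?_⟩
        · rintro rfl
          exact hab (Matrix.zero_vecMulVec b)
        · rintro rfl
          exact hab (by ext i j; simp [Matrix.vecMulVec_apply])
        · rw [Projectivization.submodule_mk, Projectivization.submodule_mk, Submodule.map_span,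
            Set.image_singleton]
      · rintro ⟨y, ⟨a, b, -, -, hy⟩, h⟩
        rw [hy, Submodule.map_span, Set.image_singleton] at h
        obtain ⟨c, -, rfl⟩ := (mk_submodule_eq_span_iff hv).mp h
        rw [eval_smul_of_isHomogeneous canonicalCubic_isHomogeneous, eval_canonicalCubic]
        simp [segreProjection, Matrix.vecMulVec_apply]
        right
        ring

open Module in
theorem isPlane_singularLocus [CharZero K] {f : MvPolynomial (Fin 5) K} (hf : f.IsHomogeneous 3)
    {g : (Fin 5 → K) ≃ₗ[K] (Fin 5 → K)} {c : K} (hc : c ≠ 0)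
    (hg : ∀ v, MvPolynomial.eval (g v) (canonicalCubic K) = c * MvPolynomial.eval v f) :
    IsPlane (singularLocus f) := by
  -- The gradient of the canonical cubic vanishes exactly where `x₃ = x₄ = 0`.
  let L : (Fin 5 → K) →ₗ[K] (Fin 2 → K) := LinearMap.funLeft K K ![3, 4]
  have hL : Function.Surjective (L ∘ₗ g.toLinearMap) := by
    have hL' : Function.Surjective L :=
      LinearMap.funLeft_surjective_of_injective K K _ (by decide)
    exact hL'.comp g.surjective
  refine ⟨LinearMap.ker (L ∘ₗ g.toLinearMap), ?_, Set.ext fun p => ?_⟩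
  · have h := LinearMap.finrank_range_add_finrank_ker (L ∘ₗ g.toLinearMap)
    rw [LinearMap.range_eq_top.mpr hL, finrank_top, finrank_fin_fun, finrank_fin_fun] at h
    omega
  · induction p using Projectivization.ind with
    | h v hv =>
      rw [mk_mem_linearSubspace, mk_mem_singularLocus hf]
      have h1 : gradient f v = 0 ↔ gradient (canonicalCubic K) (g v) = 0 := by
        have := gradient_dotProduct_of_equiv hf canonicalCubic_isHomogeneous hg v
        constructor
        · intro h
          refine dotProduct_eq _ _ fun w => ?_
          rw [← g.apply_symm_apply w, this, h, zero_dotProduct, mul_zero, zero_dotProduct]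
        · intro h
          refine dotProduct_eq _ _ fun w => ?_
          have := this w
          rw [h, zero_dotProduct] at this
          rw [zero_dotProduct]
          exact (mul_eq_zero.mp this.symm).resolve_left hc
      rw [h1, gradient_canonicalCubic, LinearMap.mem_ker, funext_iff, funext_iff]
      simp only [L, Fin.forall_fin_succ]
      simp [LinearMap.funLeft_apply]
      grind

end Model

end CubicP4

theorem mainTheorem1 (K : Type*) [Field K] [IsAlgClosed K] [CharZero K]
    (f : MvPolynomial (Fin 5) K) (hf : f.IsHomogeneous 3) (hirr : Irreducible f)
    (hhess : CubicP4.hessian f = 0) (hcone : ¬ CubicP4.IsCone (CubicP4.zeroLocus f)) :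
    CubicP4.IsPlane (CubicP4.singularLocus f) ∧
    CubicP4.ProjectivelyEquivalent (CubicP4.dualVariety f) (CubicP4.cubicScroll K) ∧
    (∃ X' : Set (ℙ K (Fin 5 → K)),
      CubicP4.IsExternalProjection (CubicP4.segreVariety K) X' ∧
      CubicP4.ProjectivelyEquivalent (CubicP4.zeroLocus f) X') ∧
    CubicP4.ProjectivelyEquivalentHypersurfaces f (CubicP4.canonicalCubic K) := by
  obtain ⟨W, hW3, hW⟩ := CubicP4.exists_plane hf hirr.ne_zero hhess hcone
  obtain ⟨g, hg⟩ := CubicP4.exists_linearEquiv hf hcone hW3 hW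
  have h6 : (6 : K) ≠ 0 := by norm_num
  have hh := CubicP4.canonicalCubic_isHomogeneous (K := K)
  have hX := CubicP4.projectivelyEquivalent_zeroLocus hf hh h6 hg
  refine ⟨CubicP4.isPlane_singularLocus hf h6 hg, ?_,
    ⟨_, CubicP4.isExternalProjection_canonicalCubic, g, hX⟩, g, hX, 6, h6, hg⟩
  rw [← CubicP4.zariskiClosure_openScroll]
  exact ((CubicP4.projectivelyEquivalent_gaussImage hf hh h6 hg).trans
    CubicP4.projectivelyEquivalent_gaussImage_canonicalCubic).zariskiClosure
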